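/- Let $d$ be a natural number, let $(B_t)_{t\ge 0}$ be a standard $d$-dimensional Brownian motion started at $0$ on a probability space, and write $E^x$ for expectation when $X_t = x + B_t$, i.e. when $X$ is Brownian motion started at $x\in\mathbb{R}^d$. Let $0\le T<\infty$ and let $f$ be a measurable, real-valued function that is non-negative on $[0,T]$. Call a function $V:\mathbb{R}^d\to[0,\infty]$ Gaussian definite if $$V(x)=\int_S e^{-\langle x, A_s x\rangle}\,d\mu(s)\qquad\text{for all }x\in\mathbb{R}^d,$$ where $\mu$ is a positive measure on a measurable space $S$ and $(A_s)_{s\in S}$ is a measurable family of (symmetric) positive definite $d\times d$ matrices. All integrals and expectations below take values in $[0,\infty]$, with $e^{\infty}=\infty$ and $0\cdot\infty=0$. 1. If $V$ is Gaussian definite, then $$\sup_{x\in\mathbb{R}^d}E^x\left[\exp\left(\int_0^T f(t)V(X_t)\,dt\right)\right]=E^0\left[\exp\left(\int_0^T f(t)V(X_t)\,dt\right)\right].$$ 2. For $0<\theta\le 2$ the function $V(x)=|x|^{-\theta}$ (with $V(0)=\infty$) is Gaussian definite. 3. Consequently, the identity in 1 holds for $V(x)=|x|^{-\theta}$ for every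 $0\le\theta\le 2$ (for $\theta=0$, $V$ is the constant $1$). -/

import Mathlib

open MeasureTheory ProbabilityTheory
open scoped NNReal ENNReal Matrix

universe u

/-- A standard `d`-dimensional Brownian motion started at the origin: the coordinate processes are
independent real Brownian motions (Gaussian finite-dimensional laws with covariance `min s t`,
almost surely continuous paths). -/
structure IsBrownianMotion {d : ℕ} {Ω : Type*} [MeasurableSpace Ω]
    (B : ℝ≥0 → Ω → EuclideanSpace ℝ (Fin d)) (P : Measure Ω) : Prop where
  coord : ∀ i : Fin d, IsBrownianReal (fun t ω => B t ω i) P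
  indep : iIndepFun (fun (i : Fin d) (ω : Ω) (t : ℝ≥0) => B t ω i) P

/-- `V : ℝᵈ → [0, ∞]` is Gaussian definite if `V x = ∫ exp (-⟨x, A_s x⟩) dμ(s)` for all `x`, where
`μ` is a positive measure on some measurable space `S` and `(A_s)` is a measurable family of
(symmetric) positive definite matrices. The value `∞` is allowed, as for `|x|^{-θ}` at `x = 0`. -/
def IsGaussianDefinite {d : ℕ} (V : EuclideanSpace ℝ (Fin d) → ℝ≥0∞) : Prop :=
  ∃ (S : Type u) (_ : MeasurableSpace S) (μ : Measure S) (A : S → Matrix (Fin d) (Fin d) ℝ),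
    (∀ i j, Measurable fun s => A s i j) ∧
    (∀ s, (A s).PosDef) ∧
    ∀ x, V x = ∫⁻ s, ENNReal.ofReal (Real.exp (-(x.ofLp ⬝ᵥ (A s *ᵥ x.ofLp)))) ∂μ

/-- `E^x[exp (∫₀ᵀ f(t) V(X_t) dt)]` with values in `[0, ∞]`, where `X_t = x + B_t` is Brownian
motion started at `x`. Here `EReal.exp ∞ = ∞`. -/
noncomputable def expFunctional {d : ℕ} {Ω : Type*} [MeasurableSpace Ω]
    (B : ℝ≥0 → Ω → EuclideanSpace ℝ (Fin d)) (P : Measure Ω) (T : ℝ) (f : ℝ → ℝ)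
    (V : EuclideanSpace ℝ (Fin d) → ℝ≥0∞) (x : EuclideanSpace ℝ (Fin d)) : ℝ≥0∞ :=
  ∫⁻ ω, EReal.exp
    ((∫⁻ t in Set.Icc 0 T, ENNReal.ofReal (f t) * V (x + B t.toNNReal ω) : ℝ≥0∞) : EReal) ∂P

/-- The potential `|x|^{-θ}` with values in `[0, ∞]`; at `x = 0` it is `∞` if `θ > 0`, and for
`θ = 0` it is the constant `1`. -/
noncomputable def powerPotential (d : ℕ) (θ : ℝ) (x : EuclideanSpace ℝ (Fin d)) : ℝ≥0∞ :=
  ENNReal.ofReal ‖x‖ ^ (-θ)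

/-!
The quantity `E^x[exp (∫ f(t) V(X_t) dt)]` is expanded into its exponential series. With
`V y = ∫ exp (-⟨y, A_s y⟩) dμ(s)`, Tonelli's theorem turns the `n`-th moment of the time integral
into an integral, against a positive measure not depending on `x`, of the expectations
`E[∏ i, exp (-⟨x + B_{t_i}, A_{s_i} (x + B_{t_i})⟩)]`, so it is enough to maximise each of these at
`x = 0` (`lintegral_exp_lintegral_le`, `expFunctional_le_zero_of_forall_prod_le`).

Each factor `exp (-⟨y, A y⟩)` is the characteristic function of a centred Gaussian with covariance
`2 A`. The expectation therefore equals `∫ exp (i ∑ ⟨x, g_i⟩) ψ(g) dγ(g)`, where `γ` is a product of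
Gaussian measures and `ψ` is the characteristic function of `(B_{t_1}, …, B_{t_n})`. Since that
vector is centred Gaussian, `ψ ≥ 0`, and the integral is largest at `x = 0`
(`lintegral_prod_gaussian_add_le`).

Tonelli's theorem needs an s-finite `μ` and a jointly measurable process. If `V` is finite at one
point, `μ` is s-finite because the integrand is positive (`sfinite_of_lintegral_ne_top`); otherwise
`V` is constantly `∞` and there is nothing to prove. As paths are only almost surely continuous,
`B` is first replaced by a jointly measurable process with almost surely the same paths
(`exists_measurable_uncurry_ae_eq_of_ae_continuous`).

That `|x|^{-θ}` is Gaussian definite is Euler's integral for the Gamma function.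
-/

/-! ### Moments and exponentials of integrals -/

theorem EReal.exp_coe_ennreal_eq_tsum (y : ℝ≥0∞) :
    EReal.exp (y : EReal) = ∑' n : ℕ, (n.factorial : ℝ≥0∞)⁻¹ * y ^ n := by
  induction y with
  | top =>
    refine (top_le_iff.1 ?_).symm
    calc (⊤ : ℝ≥0∞) = ((1 : ℕ).factorial : ℝ≥0∞)⁻¹ * ⊤ ^ 1 := by simp
      _ ≤ _ := ENNReal.le_tsum (f := fun n : ℕ => (n.factorial : ℝ≥0∞)⁻¹ * ⊤ ^ n) 1
  | coe y =>
    have h := NormedSpace.expSeries_div_hasSum_exp (y : ℝ)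
    rw [← Real.exp_eq_exp_ℝ] at h
    rw [show (((y : ℝ≥0∞) : EReal)) = ((y : ℝ) : EReal) from rfl, EReal.exp_coe, ← h.tsum_eq,
      ENNReal.ofReal_tsum_of_nonneg (fun n => by positivity) h.summable]
    refine tsum_congr fun n => ?_
    rw [ENNReal.ofReal_div_of_pos (by positivity), ENNReal.ofReal_pow y.coe_nonneg,
      ENNReal.ofReal_natCast, div_eq_mul_inv, mul_comm, ENNReal.ofReal_coe_nnreal]

/-- The weight `∏ i, F (z i) ω` carried along makes the induction on the power `k` go through
with Tonelli's theorem alone: one factor `∫ F` becomes one more frozen factor `F z`. -/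
theorem lintegral_prod_mul_lintegral_pow_le {Z Ω : Type*} [MeasurableSpace Z] [MeasurableSpace Ω]
    (ν : Measure Z) [SFinite ν] (P : Measure Ω) [SFinite P] {F G : Z → Ω → ℝ≥0∞}
    (hF : Measurable (Function.uncurry F)) (hG : Measurable (Function.uncurry G))
    (h : ∀ (n : ℕ) (z : Fin n → Z),
      ∫⁻ ω, ∏ i, F (z i) ω ∂P ≤ ∫⁻ ω, ∏ i, G (z i) ω ∂P) (k : ℕ) :
    ∀ (n : ℕ) (z : Fin n → Z),
      ∫⁻ ω, (∏ i, F (z i) ω) * (∫⁻ z, F z ω ∂ν) ^ k ∂P ≤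
        ∫⁻ ω, (∏ i, G (z i) ω) * (∫⁻ z, G z ω ∂ν) ^ k ∂P := by
  induction k with
  | zero => simpa using h
  | succ k ih =>
    intro n z
    have key : ∀ H : Z → Ω → ℝ≥0∞, Measurable (Function.uncurry H) →
        ∫⁻ ω, (∏ i, H (z i) ω) * (∫⁻ z, H z ω ∂ν) ^ (k + 1) ∂P =
          ∫⁻ y, ∫⁻ ω, (∏ i : Fin (n + 1), H (Fin.cons (α := fun _ => Z) y z i) ω) *
            (∫⁻ z, H z ω ∂ν) ^ k ∂P ∂ν := by
      intro H hH
      have hz : ∀ y, Measurable (H y) := fun y => hH.comp measurable_prodMk_left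
      have hI : Measurable fun ω => ∫⁻ z, H z ω ∂ν :=
        Measurable.lintegral_prod_left' (f := fun p : Z × Ω => H p.1 p.2) hH
      rw [lintegral_lintegral_swap]
      · refine lintegral_congr fun ω => ?_
        simp only [Fin.prod_univ_succ, Fin.cons_zero, Fin.cons_succ]
        rw [pow_succ]
        have hm : Measurable fun y => H y ω := hH.comp measurable_prodMk_right
        simp_rw [mul_assoc]
        rw [lintegral_mul_const _ hm]
        ring
      · simp only [Fin.prod_univ_succ, Fin.cons_zero, Fin.cons_succ]
        refine Measurable.aemeasurable ?_
        refine ((Measurable.mul hH ?_)).mul ?_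
        · exact Finset.measurable_prod _ fun i _ => (hz (z i)).comp measurable_snd
        · exact (hI.pow_const k).comp measurable_snd
    rw [key F hF, key G hG]
    exact lintegral_mono fun y => ih _ _

theorem lintegral_exp_lintegral_le {Z Ω : Type*} [MeasurableSpace Z] [MeasurableSpace Ω]
    (ν : Measure Z) [SFinite ν] (P : Measure Ω) [SFinite P] {F G : Z → Ω → ℝ≥0∞}
    (hF : Measurable (Function.uncurry F)) (hG : Measurable (Function.uncurry G))
    (h : ∀ (n : ℕ) (z : Fin n → Z),
      ∫⁻ ω, ∏ i, F (z i) ω ∂P ≤ ∫⁻ ω, ∏ i, G (z i) ω ∂P) :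
    ∫⁻ ω, EReal.exp ((∫⁻ z, F z ω ∂ν : ℝ≥0∞) : EReal) ∂P ≤
      ∫⁻ ω, EReal.exp ((∫⁻ z, G z ω ∂ν : ℝ≥0∞) : EReal) ∂P := by
  have hI : ∀ H : Z → Ω → ℝ≥0∞, Measurable (Function.uncurry H) →
      Measurable fun ω => ∫⁻ z, H z ω ∂ν := fun H hH =>
    Measurable.lintegral_prod_left' (f := fun p : Z × Ω => H p.1 p.2) hH
  simp_rw [EReal.exp_coe_ennreal_eq_tsum]
  rw [lintegral_tsum fun n => (((hI F hF).pow_const n).const_mul _).aemeasurable,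
    lintegral_tsum fun n => (((hI G hG).pow_const n).const_mul _).aemeasurable]
  refine ENNReal.tsum_le_tsum fun n => ?_
  rw [lintegral_const_mul _ ((hI F hF).pow_const n), lintegral_const_mul _ ((hI G hG).pow_const n)]
  refine mul_le_mul' le_rfl ?_
  simpa using lintegral_prod_mul_lintegral_pow_le ν P hF hG h n 0 Fin.elim0

/-! ### Measurability -/

/-- A process with almost surely continuous paths agrees, outside one null set, with a jointly
measurable process. -/
theorem exists_measurable_uncurry_ae_eq_of_ae_continuous {ι Ω E : Type*} [TopologicalSpace ι]
    [TopologicalSpace.MetrizableSpace ι] [MeasurableSpace ι] [SecondCountableTopology ι]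
    [Nonempty ι] [OpensMeasurableSpace ι] [MeasurableSpace Ω] [TopologicalSpace E]
    [TopologicalSpace.PseudoMetrizableSpace E] [Zero E] [MeasurableSpace E] [BorelSpace E]
    {P : Measure Ω} {X : ι → Ω → E} (hX : ∀ t, AEMeasurable (X t) P)
    (hc : ∀ᵐ ω ∂P, Continuous fun t => X t ω) :
    ∃ Y : ι → Ω → E, Measurable (Function.uncurry Y) ∧ ∀ᵐ ω ∂P, ∀ t, X t ω = Y t ω := by
  classical
  let q := TopologicalSpace.denseSeq ι
  have hq : ∀ᵐ ω ∂P, ∀ n, X (q n) ω = (hX (q n)).mk _ ω :=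
    ae_all_iff.2 fun n => (hX (q n)).ae_eq_mk
  have hgood := hc.and hq
  let N := toMeasurable P {ω | ¬ (Continuous (fun t => X t ω) ∧
    ∀ n, X (q n) ω = (hX (q n)).mk _ ω)}
  have hNm : MeasurableSet N := measurableSet_toMeasurable _ _
  have hN : P N = 0 := by rw [measure_toMeasurable]; exact hgood
  have hNc : ∀ ω ∉ N, Continuous (fun t => X t ω) ∧
      ∀ n, X (q n) ω = (hX (q n)).mk _ ω := fun ω hω => by
    by_contra h
    exact hω (subset_toMeasurable _ _ h)
  -- Killing `X` on the null set `N` makes every path continuous, and on a countable dense set of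
  -- times the result is measurable; continuity extends this to all times.
  let Y : ι → Ω → E := fun t => Nᶜ.indicator (X t)
  have hYc : ∀ ω, Continuous fun t => Y t ω := by
    intro ω
    by_cases hω : ω ∈ N
    · simp [Y, hω, continuous_const]
    · simpa [Y, hω] using (hNc ω hω).1
  have hYq : ∀ n, Measurable (Y (q n)) := by
    intro n
    have : Y (q n) = Nᶜ.indicator ((hX (q n)).mk _) := by
      refine Set.indicator_congr fun ω hω => (hNc ω hω).2 n
    rw [this]
    exact (hX (q n)).measurable_mk.indicator hNm.compl
  have hYm : ∀ t, Measurable (Y t) := by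
    intro t
    have ht : t ∈ closure (Set.range q) := TopologicalSpace.denseRange_denseSeq ι t
    obtain ⟨u, hu, hut⟩ := mem_closure_iff_seq_limit.1 ht
    choose m hm using hu
    refine measurable_of_tendsto_metrizable (f := fun n => Y (u n))
      (fun n => hm n ▸ hYq (m n)) ?_
    exact tendsto_pi_nhds.2 fun ω => ((hYc ω).tendsto t).comp hut
  refine ⟨Y, ?_, ?_⟩
  · exact measurable_uncurry_of_continuous_of_measurable hYc hYm
  · filter_upwards [measure_eq_zero_iff_ae_notMem.1 hN] with ω hω t
    simp [Y, hω]

/-- A positive finite-valued function with finite integral has a finite weighted measure, and `μ` is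
recovered from that measure through the reciprocal density. -/
theorem sfinite_of_lintegral_ne_top {S : Type*} [MeasurableSpace S] {μ : Measure S}
    {g : S → ℝ≥0∞} (hg : Measurable g) (h0 : ∀ s, g s ≠ 0) (htop : ∀ s, g s ≠ ∞)
    (h : ∫⁻ s, g s ∂μ ≠ ∞) : SFinite μ := by
  have : IsFiniteMeasure (μ.withDensity g) := isFiniteMeasure_withDensity h
  rw [← withDensity_inv_same (μ := μ) hg (.of_forall h0) (.of_forall htop)]
  infer_instance

theorem IsBrownianMotion.aemeasurable {d : ℕ} {Ω : Type*} [MeasurableSpace Ω] {P : Measure Ω}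
    {B : ℝ≥0 → Ω → EuclideanSpace ℝ (Fin d)} (hB : IsBrownianMotion B P) (t : ℝ≥0) :
    AEMeasurable (B t) P :=
  (PiLp.continuous_toLp 2 _).measurable.comp_aemeasurable
    (aemeasurable_pi_lambda (fun ω i => B t ω i) fun i => (hB.coord i).aemeasurable t)

theorem IsBrownianMotion.ae_continuous {d : ℕ} {Ω : Type*} [MeasurableSpace Ω] {P : Measure Ω}
    {B : ℝ≥0 → Ω → EuclideanSpace ℝ (Fin d)} (hB : IsBrownianMotion B P) :
    ∀ᵐ ω ∂P, Continuous fun t => B t ω := by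
  filter_upwards [ae_all_iff.2 fun i => (hB.coord i).cont] with ω hω
  exact (PiLp.continuous_toLp 2 _).comp (continuous_pi hω)

/-! ### Gaussian factors and Fourier transforms -/

open scoped ComplexOrder in
theorem ProbabilityTheory.IsBrownianReal.integral_cexp_sum_nonneg {Ω : Type*} [MeasurableSpace Ω]
    {P : Measure Ω} {X : ℝ≥0 → Ω → ℝ} (hX : IsBrownianReal X P) {n : ℕ} (t : Fin n → ℝ≥0) (c : Fin n → ℝ) :
    0 ≤ ∫ ω, Complex.exp ((∑ i, c i * X (t i) ω : ℝ) * Complex.I) ∂P := by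
  have hG : HasGaussianLaw (fun ω => ∑ i, c i * X (t i) ω) P :=
    ((hX.isGaussianProcess.comp_right t).smul c).hasGaussianLaw_fun_sum (I := Finset.univ)
  have h0 : ∫ ω, ∑ i, c i * X (t i) ω ∂P = 0 := by
    rw [integral_finsetSum _ fun i _ => (hX.integrable_eval (t i)).const_mul (c i)]
    refine Finset.sum_eq_zero fun i _ => ?_
    rw [integral_const_mul, hX.integral_eval, mul_zero]
  have h1 : ∫ ω, Complex.exp ((∑ i, c i * X (t i) ω : ℝ) * Complex.I) ∂P =
      charFun (P.map fun ω => ∑ i, c i * X (t i) ω) 1 := by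
    rw [charFun_apply_real, integral_map hG.aemeasurable (by fun_prop)]
    simp
  rw [h1, hG.map_eq_gaussianReal, h0, charFun_gaussianReal]
  simp only [Complex.ofReal_zero, Complex.ofReal_one, mul_zero, zero_mul, zero_sub, one_pow,
    mul_one]
  have : (0 : ℝ) ≤ Real.exp (-((Var[fun ω => ∑ i, c i * X (t i) ω; P].toNNReal : ℝ) / 2)) :=
    (Real.exp_pos _).le
  exact_mod_cast this

open scoped ComplexOrder InnerProductSpace in
/-- The finite-dimensional laws of a Brownian motion have non-negative characteristic functions,
being centred Gaussian. -/
theorem IsBrownianMotion.integral_cexp_sum_inner_nonneg {d : ℕ} {Ω : Type*} [MeasurableSpace Ω]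
    {P : Measure Ω} {B : ℝ≥0 → Ω → EuclideanSpace ℝ (Fin d)} (hB : IsBrownianMotion B P)
    {n : ℕ} (t : Fin n → ℝ≥0) (g : Fin n → EuclideanSpace ℝ (Fin d)) :
    0 ≤ ∫ ω, Complex.exp ((∑ i, ⟪B (t i) ω, g i⟫_ℝ : ℝ) * Complex.I) ∂P := by
  let φ : Fin d → (ℝ≥0 → ℝ) → ℂ := fun j x =>
    Complex.exp ((∑ i, g i j * x (t i) : ℝ) * Complex.I)
  have hφ : ∀ j, Measurable (φ j) := fun j => by fun_prop
  have hind := hB.indep.comp φ hφ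
  have hsum : ∀ ω, Complex.exp ((∑ i, ⟪B (t i) ω, g i⟫_ℝ : ℝ) * Complex.I) =
      ∏ j, φ j (fun s => B s ω j) := by
    intro ω
    simp only [φ]
    rw [← Complex.exp_sum, ← Finset.sum_mul, ← Complex.ofReal_sum, Finset.sum_comm]
    simp [PiLp.inner_apply]
  have hm : ∀ j, AEStronglyMeasurable (fun ω => φ j (fun s => B s ω j)) P := by
    intro j
    have : ∀ i, AEMeasurable (fun ω => B (t i) ω j) P := fun i => (hB.coord j).aemeasurable (t i)
    simp only [φ]
    exact AEMeasurable.aestronglyMeasurable (by fun_prop)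
  simp_rw [hsum]
  have h := hind.integral_fun_prod_eq_prod_integral hm
  simp only [Function.comp_apply] at h
  rw [h]
  exact Finset.prod_nonneg fun j _ => (hB.coord j).integral_cexp_sum_nonneg t fun i => g i j

open scoped InnerProductSpace in
/-- `exp (-⟨x, A x⟩)` is the Fourier transform of the centred Gaussian with covariance `2 A`. -/
theorem integral_cexp_inner_multivariateGaussian {d : ℕ} {A : Matrix (Fin d) (Fin d) ℝ}
    (hA : A.PosDef) (x : EuclideanSpace ℝ (Fin d)) :
    ∫ g, Complex.exp ((⟪x, g⟫_ℝ : ℝ) * Complex.I) ∂(multivariateGaussian 0 ((2 : ℝ) • A)) =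
      (Real.exp (-(x.ofLp ⬝ᵥ (A *ᵥ x.ofLp))) : ℂ) := by
  have h := charFun_multivariateGaussian (μ := (0 : EuclideanSpace ℝ (Fin d)))
    (hA.posSemidef.smul (by norm_num : (0 : ℝ) ≤ 2)) x
  rw [charFun_apply] at h
  simp_rw [real_inner_comm x] at h ⊢
  rw [h, Complex.ofReal_exp]
  congr 1
  simp [Matrix.smul_mulVec, dotProduct_smul]

open scoped InnerProductSpace in
theorem integrable_cexp_sum_inner_add {d n : ℕ} {Ω : Type*} [MeasurableSpace Ω] {P : Measure Ω}
    [IsFiniteMeasure P] {Y : Fin n → Ω → EuclideanSpace ℝ (Fin d)} (hY : ∀ i, AEMeasurable (Y i) P)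
    (γ : Measure (Fin n → EuclideanSpace ℝ (Fin d))) [IsFiniteMeasure γ]
    (x : EuclideanSpace ℝ (Fin d)) :
    Integrable (fun p : Ω × (Fin n → EuclideanSpace ℝ (Fin d)) =>
      Complex.exp ((∑ i, ⟪x + Y i p.1, p.2 i⟫_ℝ : ℝ) * Complex.I)) (P.prod γ) := by
  have hY' : ∀ i, AEMeasurable (fun p : Ω × (Fin n → EuclideanSpace ℝ (Fin d)) => Y i p.1)
      (P.prod γ) := fun i => (hY i).comp_fst
  refine Integrable.of_bound (C := 1) (AEMeasurable.aestronglyMeasurable ?_)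
    (.of_forall fun p => (Complex.norm_exp_ofReal_mul_I _).le)
  have h : AEMeasurable (fun p : Ω × (Fin n → EuclideanSpace ℝ (Fin d)) =>
      ∑ i, ⟪x + Y i p.1, p.2 i⟫_ℝ) (P.prod γ) := by
    refine Finset.aemeasurable_fun_sum _ fun i _ => ?_
    exact ((hY' i).const_add x).inner
      ((measurable_pi_apply i).comp measurable_snd).aemeasurable
  exact ((Complex.measurable_ofReal.comp_aemeasurable h).mul_const _).cexp

open scoped ComplexOrder InnerProductSpace in
/-- Writing each Gaussian factor as a Fourier transform turns the left side into
`∫ exp (i ∑ ⟨x, g i⟩) ψ(g) dγ(g)`, where `ψ` is the characteristic function of `(Y i)`. As `ψ ≥ 0`,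
the modulus is largest at `x = 0`. -/
theorem lintegral_prod_gaussian_add_le {d n : ℕ} {Ω : Type*} [MeasurableSpace Ω] {P : Measure Ω}
    [IsProbabilityMeasure P] {Y : Fin n → Ω → EuclideanSpace ℝ (Fin d)}
    (hY : ∀ i, AEMeasurable (Y i) P)
    (hψ : ∀ g : Fin n → EuclideanSpace ℝ (Fin d),
      0 ≤ ∫ ω, Complex.exp ((∑ i, ⟪Y i ω, g i⟫_ℝ : ℝ) * Complex.I) ∂P)
    {A : Fin n → Matrix (Fin d) (Fin d) ℝ} (hA : ∀ i, (A i).PosDef)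
    (x : EuclideanSpace ℝ (Fin d)) :
    ∫⁻ ω, ∏ i, ENNReal.ofReal
        (Real.exp (-((x + Y i ω).ofLp ⬝ᵥ (A i *ᵥ (x + Y i ω).ofLp)))) ∂P ≤
      ∫⁻ ω, ∏ i, ENNReal.ofReal
        (Real.exp (-((0 + Y i ω).ofLp ⬝ᵥ (A i *ᵥ (0 + Y i ω).ofLp)))) ∂P := by
  let γ : Measure (Fin n → EuclideanSpace ℝ (Fin d)) :=
    Measure.pi fun i => multivariateGaussian 0 ((2 : ℝ) • A i)
  let ψ : (Fin n → EuclideanSpace ℝ (Fin d)) → ℂ := fun g =>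
    ∫ ω, Complex.exp ((∑ i, ⟪Y i ω, g i⟫_ℝ : ℝ) * Complex.I) ∂P
  let K : EuclideanSpace ℝ (Fin d) → Ω → ℝ := fun x ω =>
    ∏ i, Real.exp (-((x + Y i ω).ofLp ⬝ᵥ (A i *ᵥ (x + Y i ω).ofLp)))
  have hKm : ∀ x, AEStronglyMeasurable (K x) P := by
    intro x
    refine AEMeasurable.aestronglyMeasurable ?_
    have : Measurable fun y : Fin n → EuclideanSpace ℝ (Fin d) =>
        ∏ i, Real.exp (-((x + y i).ofLp ⬝ᵥ (A i *ᵥ (x + y i).ofLp))) := by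
      simp only [dotProduct, Matrix.mulVec]
      fun_prop
    exact this.comp_aemeasurable (aemeasurable_pi_lambda _ hY)
  have hK0 : ∀ x ω, 0 ≤ K x ω := fun x ω => Finset.prod_nonneg fun i _ => (Real.exp_pos _).le
  have hK1 : ∀ x ω, K x ω ≤ 1 := fun x ω =>
    Finset.prod_le_one (fun i _ => (Real.exp_pos _).le) fun i _ => by
      have := (hA i).posSemidef.dotProduct_mulVec_nonneg (x + Y i ω).ofLp
      simp only [star_trivial] at this
      exact Real.exp_le_one_iff.2 (by linarith)
  have hKi : ∀ x, Integrable (K x) P := fun x =>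
    Integrable.of_bound (hKm x) 1 (.of_forall fun ω => by
      rw [Real.norm_of_nonneg (hK0 x ω)]; exact hK1 x ω)
  have hKγ : ∀ x ω, (K x ω : ℂ) =
      ∫ g, Complex.exp ((∑ i, ⟪x + Y i ω, g i⟫_ℝ : ℝ) * Complex.I) ∂γ := by
    intro x ω
    simp_rw [Complex.ofReal_sum, Finset.sum_mul, Complex.exp_sum]
    rw [integral_fintype_prod_eq_prod
      (fun i (v : EuclideanSpace ℝ (Fin d)) => Complex.exp (⟪x + Y i ω, v⟫_ℝ * Complex.I))]
    simp_rw [integral_cexp_inner_multivariateGaussian (hA _)]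
    simp [K]
  have hmain : ∀ x, ((∫ ω, K x ω ∂P : ℝ) : ℂ) =
      ∫ g, Complex.exp ((∑ i, ⟪x, g i⟫_ℝ : ℝ) * Complex.I) * ψ g ∂γ := by
    intro x
    rw [← integral_complex_ofReal]
    simp_rw [hKγ]
    rw [integral_integral_swap]
    · refine integral_congr_ae (.of_forall fun g => ?_)
      simp only [ψ]
      rw [← integral_const_mul]
      refine integral_congr_ae (.of_forall fun ω => ?_)
      simp only [inner_add_left, Finset.sum_add_distrib, Complex.ofReal_add, add_mul,
        Complex.exp_add]
    · exact integrable_cexp_sum_inner_add hY γ x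
  have hle : ∫ ω, K x ω ∂P ≤ ∫ ω, K 0 ω ∂P := by
    have h0 : ((∫ ω, K 0 ω ∂P : ℝ) : ℂ) = ((∫ g, ‖ψ g‖ ∂γ : ℝ) : ℂ) := by
      rw [hmain 0, ← integral_complex_ofReal]
      refine integral_congr_ae (.of_forall fun g => ?_)
      simpa using Complex.eq_coe_norm_of_nonneg (show 0 ≤ ψ g from hψ g)
    rw [Complex.ofReal_inj] at h0
    calc ∫ ω, K x ω ∂P ≤ ‖((∫ ω, K x ω ∂P : ℝ) : ℂ)‖ := by
          rw [Complex.norm_real]; exact le_abs_self _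
      _ ≤ ∫ g, ‖ψ g‖ ∂γ := by
          rw [hmain x]
          refine (norm_integral_le_integral_norm _).trans_eq ?_
          simp only [norm_mul, Complex.norm_exp_ofReal_mul_I, one_mul]
      _ = _ := h0.symm
  have hconv : ∀ x, ∫⁻ ω, ∏ i, ENNReal.ofReal
      (Real.exp (-((x + Y i ω).ofLp ⬝ᵥ (A i *ᵥ (x + Y i ω).ofLp)))) ∂P =
      ENNReal.ofReal (∫ ω, K x ω ∂P) := by
    intro x
    rw [ofReal_integral_eq_lintegral_ofReal (hKi x) (.of_forall (hK0 x))]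
    refine lintegral_congr fun ω => ?_
    rw [ENNReal.ofReal_prod_of_nonneg fun i _ => (Real.exp_pos _).le]
  rw [hconv, hconv]
  exact ENNReal.ofReal_le_ofReal hle

/-! ### The exponential functional of a Gaussian definite potential -/

theorem expFunctional_congr {d : ℕ} {Ω : Type*} [MeasurableSpace Ω] {P : Measure Ω}
    {B B' : ℝ≥0 → Ω → EuclideanSpace ℝ (Fin d)} (h : ∀ᵐ ω ∂P, ∀ t, B t ω = B' t ω)
    (T : ℝ) (f : ℝ → ℝ) (V : EuclideanSpace ℝ (Fin d) → ℝ≥0∞) (x : EuclideanSpace ℝ (Fin d)) :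
    expFunctional B P T f V x = expFunctional B' P T f V x := by
  refine lintegral_congr_ae ?_
  filter_upwards [h] with ω hω
  simp only [hω]

theorem measurable_uncurry_exp_neg_dotProduct_mulVec {d : ℕ} {S : Type*} [MeasurableSpace S]
    {A : S → Matrix (Fin d) (Fin d) ℝ} (hA : ∀ i j, Measurable fun s => A s i j) :
    Measurable (Function.uncurry fun (y : EuclideanSpace ℝ (Fin d)) (s : S) =>
      ENNReal.ofReal (Real.exp (-(y.ofLp ⬝ᵥ (A s *ᵥ y.ofLp))))) := by
  have h1 : ∀ i j, Measurable fun p : EuclideanSpace ℝ (Fin d) × S => A p.2 i j :=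
    fun i j => (hA i j).comp measurable_snd
  simp only [Function.uncurry_def, dotProduct, Matrix.mulVec]
  fun_prop

/-- The time integral of a potential `V = ∫ q · s dμ(s)` along a path, as a single integral over
`[0, T] × S` in which the weight `f` is absorbed into the measure. -/
theorem setLIntegral_mul_lintegral_eq_lintegral_prod {E S : Type*} [MeasurableSpace E]
    [MeasurableSpace S] {μ : Measure S} [SFinite μ] (T : ℝ) {f : ℝ → ℝ} (hf : Measurable f)
    {q : E → S → ℝ≥0∞} (hq : Measurable (Function.uncurry q)) {w : ℝ → E} (hw : Measurable w) :
    ∫⁻ t in Set.Icc 0 T, ENNReal.ofReal (f t) * ∫⁻ s, q (w t) s ∂μ =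
      ∫⁻ z, q (w z.1) z.2 ∂(((volume.restrict (Set.Icc 0 T)).withDensity
        fun t => ENNReal.ofReal (f t)).prod μ) := by
  have hm : Measurable fun z : ℝ × S => q (w z.1) z.2 :=
    hq.comp ((hw.comp measurable_fst).prodMk measurable_snd)
  rw [lintegral_prod _ hm.aemeasurable,
    lintegral_withDensity_eq_lintegral_mul _ (by fun_prop) hm.lintegral_prod_right']
  rfl

/-- Expanding the exponential reduces a comparison of exponential functionals to a comparison of
the expectations of finite products of the kernel `q` along the process. -/
theorem expFunctional_le_zero_of_forall_prod_le {d : ℕ} {Ω S : Type*} [MeasurableSpace Ω]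
    [MeasurableSpace S] {P : Measure Ω} [SFinite P] {μ : Measure S} [SFinite μ]
    {B : ℝ≥0 → Ω → EuclideanSpace ℝ (Fin d)} (hB : Measurable (Function.uncurry B)) (T : ℝ)
    {f : ℝ → ℝ} (hf : Measurable f) {V : EuclideanSpace ℝ (Fin d) → ℝ≥0∞}
    {q : EuclideanSpace ℝ (Fin d) → S → ℝ≥0∞} (hq : Measurable (Function.uncurry q))
    (hV : ∀ y, V y = ∫⁻ s, q y s ∂μ) (x : EuclideanSpace ℝ (Fin d))
    (h : ∀ (n : ℕ) (t : Fin n → ℝ≥0) (s : Fin n → S),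
      ∫⁻ ω, ∏ i, q (x + B (t i) ω) (s i) ∂P ≤ ∫⁻ ω, ∏ i, q (0 + B (t i) ω) (s i) ∂P) :
    expFunctional B P T f V x ≤ expFunctional B P T f V 0 := by
  have hpath : ∀ x, Measurable fun p : ℝ × Ω => x + B p.1.toNNReal p.2 := fun x =>
    (hB.comp (f := fun p : ℝ × Ω => (p.1.toNNReal, p.2)) (by fun_prop)).const_add x
  have key : ∀ x ω, ∫⁻ t in Set.Icc 0 T, ENNReal.ofReal (f t) * V (x + B t.toNNReal ω) =
      ∫⁻ z, q (x + B z.1.toNNReal ω) z.2 ∂(((volume.restrict (Set.Icc 0 T)).withDensity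
        fun t => ENNReal.ofReal (f t)).prod μ) := fun x ω => by
    simp only [hV]
    exact setLIntegral_mul_lintegral_eq_lintegral_prod T hf hq (w := fun t => x + B t.toNNReal ω)
      ((hpath x).comp measurable_prodMk_right)
  have hF : ∀ x, Measurable (Function.uncurry fun (z : ℝ × S) (ω : Ω) =>
      q (x + B z.1.toNNReal ω) z.2) := fun x =>
    hq.comp (((hpath x).comp (f := fun p : (ℝ × S) × Ω => (p.1.1, p.2)) (by fun_prop)).prodMk
      (measurable_snd.comp measurable_fst))
  simp only [expFunctional, key]
  exact lintegral_exp_lintegral_le _ P (hF x) (hF 0) fun n z => h n _ _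

open scoped ComplexOrder in
theorem expFunctional_le_zero_of_isGaussianDefinite {d : ℕ} {Ω : Type*} [MeasurableSpace Ω]
    {P : Measure Ω} [IsProbabilityMeasure P] {B : ℝ≥0 → Ω → EuclideanSpace ℝ (Fin d)}
    (hB : IsBrownianMotion B P) (T : ℝ) {f : ℝ → ℝ} (hf : Measurable f)
    {V : EuclideanSpace ℝ (Fin d) → ℝ≥0∞} (hV : IsGaussianDefinite.{u} V)
    (x : EuclideanSpace ℝ (Fin d)) :
    expFunctional B P T f V x ≤ expFunctional B P T f V 0 := by
  obtain ⟨S, _, μ, A, hAm, hA, hVA⟩ := hV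
  by_cases htop : ∀ y, V y = ∞
  · simp only [expFunctional, htop, le_refl]
  push Not at htop
  obtain ⟨y, hy⟩ := htop
  have hq := measurable_uncurry_exp_neg_dotProduct_mulVec hAm
  -- The integrand is positive everywhere, so one finite value of `V` forces `μ` to be s-finite.
  have : SFinite μ := sfinite_of_lintegral_ne_top (hq.of_uncurry_left (x := y))
    (fun s => by simp [Real.exp_pos]) (fun s => ENNReal.ofReal_ne_top) (hVA y ▸ hy)
  obtain ⟨B', hB'm, hBB'⟩ :=
    exists_measurable_uncurry_ae_eq_of_ae_continuous hB.aemeasurable hB.ae_continuous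
  rw [expFunctional_congr hBB', expFunctional_congr hBB']
  have hae : ∀ t, B t =ᵐ[P] B' t := fun t => hBB'.mono fun ω hω => hω t
  refine expFunctional_le_zero_of_forall_prod_le hB'm T hf hq hVA x fun n t s => ?_
  refine lintegral_prod_gaussian_add_le (Y := fun i => B' (t i))
    (fun i => (hB.aemeasurable _).congr (hae _)) (fun g => ?_) (fun i => hA (s i)) x
  refine (hB.integral_cexp_sum_inner_nonneg t g).trans_eq (integral_congr_ae ?_)
  filter_upwards [hBB'] with ω hω
  simp only [hω]

theorem iSup_expFunctional_eq_of_isGaussianDefinite {d : ℕ} {Ω : Type*} [MeasurableSpace Ω]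
    {P : Measure Ω} [IsProbabilityMeasure P] {B : ℝ≥0 → Ω → EuclideanSpace ℝ (Fin d)}
    (hB : IsBrownianMotion B P) (T : ℝ) {f : ℝ → ℝ} (hf : Measurable f)
    {V : EuclideanSpace ℝ (Fin d) → ℝ≥0∞} (hV : IsGaussianDefinite.{u} V) :
    (⨆ x, expFunctional B P T f V x) = expFunctional B P T f V 0 :=
  le_antisymm (iSup_le fun x => expFunctional_le_zero_of_isGaussianDefinite hB T hf hV x)
    (le_iSup (fun x => expFunctional B P T f V x) 0)

/-! ### Power potentials -/

/-- For `x ≠ 0` this is Euler's integral for the Gamma function, with `μ(ds) = s^{θ/2-1} ds /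
Γ(θ/2)` on `(0, ∞)` and `A_s = s • 1`. On the null set `s ≤ 0` the matrix `1` is used instead, as
`A_s` must be positive definite for every `s`. -/
theorem isGaussianDefinite_powerPotential (d : ℕ) {θ : ℝ} (hθ : 0 < θ) :
    IsGaussianDefinite.{0} (powerPotential d θ) := by
  have ha : 0 < θ / 2 := by positivity
  have hdens : Measurable fun s : ℝ => ENNReal.ofReal (s ^ (θ / 2 - 1) / Real.Gamma (θ / 2)) := by
    fun_prop
  refine ⟨ℝ, inferInstance, (volume.restrict (Set.Ioi 0)).withDensity fun s =>
      ENNReal.ofReal (s ^ (θ / 2 - 1) / Real.Gamma (θ / 2)),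
    fun s => if 0 < s then s • 1 else 1, ?_, ?_, ?_⟩
  · intro i j
    have : (fun s : ℝ => (if 0 < s then s • (1 : Matrix (Fin d) (Fin d) ℝ) else 1) i j) =
        fun s : ℝ => if 0 < s then s * (1 : Matrix (Fin d) (Fin d) ℝ) i j else
          (1 : Matrix (Fin d) (Fin d) ℝ) i j := by
      ext s; split_ifs <;> simp
    rw [this]
    exact Measurable.ite measurableSet_Ioi (by fun_prop) measurable_const
  · intro s
    dsimp only
    split_ifs with hs
    · exact Matrix.PosDef.one.smul hs
    · exact Matrix.PosDef.one
  · intro x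
    rw [lintegral_withDensity_eq_lintegral_mul_non_measurable _ hdens (by simp)]
    have hx : x.ofLp ⬝ᵥ x.ofLp = ‖x‖ ^ 2 := by
      rw [EuclideanSpace.real_norm_sq_eq]; simp [dotProduct, sq]
    have h1 : ∀ s ∈ Set.Ioi (0 : ℝ), ((fun s : ℝ => ENNReal.ofReal (s ^ (θ / 2 - 1) /
        Real.Gamma (θ / 2))) * fun s : ℝ => ENNReal.ofReal (Real.exp (-(x.ofLp ⬝ᵥ
          ((if 0 < s then s • (1 : Matrix (Fin d) (Fin d) ℝ) else 1) *ᵥ x.ofLp)))) : ℝ → ℝ≥0∞) s =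
        ENNReal.ofReal (s ^ (θ / 2 - 1) / Real.Gamma (θ / 2) * Real.exp (-(‖x‖ ^ 2 * s))) := by
      intro s hs
      have hs' : 0 < s := hs
      simp only [Pi.mul_apply, if_pos hs', Matrix.smul_mulVec, Matrix.one_mulVec, dotProduct_smul,
        hx, smul_eq_mul]
      rw [← ENNReal.ofReal_mul (by positivity), mul_comm s]
    rw [setLIntegral_congr_fun measurableSet_Ioi h1, powerPotential]
    rcases eq_or_ne x 0 with rfl | hx0
    · -- At the origin the integrand is a pure power, which is not integrable on `(0, ∞)`.
      simp only [norm_zero, ENNReal.ofReal_zero]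
      rw [ENNReal.zero_rpow_of_neg (by linarith)]
      by_contra hne
      refine not_integrableOn_Ioi_rpow (θ / 2 - 1) ?_
      have hi : IntegrableOn (fun s : ℝ => s ^ (θ / 2 - 1) / Real.Gamma (θ / 2)) (Set.Ioi 0) := by
        refine ⟨by fun_prop, ?_⟩
        rw [hasFiniteIntegral_iff_ofReal]
        · refine lt_top_iff_ne_top.2 fun h => hne ?_
          rw [← h]
          simp
        · filter_upwards [ae_restrict_mem measurableSet_Ioi] with s hs
          have hs' : 0 < s := hs
          have := Real.Gamma_pos_of_pos ha
          simp only [Pi.zero_apply]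
          positivity
      refine IntegrableOn.congr_fun (hi.mul_const (Real.Gamma (θ / 2))) (fun s _ => ?_)
        measurableSet_Ioi
      exact div_mul_cancel₀ _ (Real.Gamma_pos_of_pos ha).ne'
    · -- Up to the factor `‖x‖ ^ θ`, the integrand is the density of a Gamma distribution.
      have hr : 0 < ‖x‖ ^ 2 := by positivity
      have hpdf := lintegral_gammaPDF_eq_one ha hr
      have h2 : ∫⁻ s, gammaPDF (θ / 2) (‖x‖ ^ 2) s = ENNReal.ofReal (‖x‖ ^ θ) *
          ∫⁻ s in Set.Ioi (0 : ℝ), ENNReal.ofReal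
            (s ^ (θ / 2 - 1) / Real.Gamma (θ / 2) * Real.exp (-(‖x‖ ^ 2 * s))) := by
        rw [← lintegral_add_compl _ measurableSet_Iic (A := Set.Iic (0:ℝ)),
          show ∫⁻ s in Set.Iic (0 : ℝ), gammaPDF (θ / 2) (‖x‖ ^ 2) s = 0 by
            rw [setLIntegral_congr Iio_ae_eq_Iic.symm]
            exact lintegral_gammaPDF_of_nonpos le_rfl, zero_add, Set.compl_Iic,
          ← lintegral_const_mul _ (by fun_prop)]
        refine setLIntegral_congr_fun measurableSet_Ioi fun s hs => ?_
        have hs' : 0 < s := hs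
        simp only [gammaPDF, gammaPDFReal, if_pos hs'.le]
        rw [← ENNReal.ofReal_mul (by positivity), ← Real.rpow_natCast,
          ← Real.rpow_mul (norm_nonneg _)]
        congr 1
        rw [show ((2 : ℕ) : ℝ) * (θ / 2) = θ by push_cast; ring]
        ring
      rw [hpdf] at h2
      rw [ENNReal.ofReal_rpow_of_pos (norm_pos_iff.2 hx0), Real.rpow_neg (norm_nonneg _),
        ENNReal.ofReal_inv_of_pos (by positivity)]
      exact (ENNReal.eq_inv_of_mul_eq_one_left (by rw [mul_comm, ← h2])).symm

theorem mainTheorem4 {d : ℕ} {Ω : Type*} [MeasurableSpace Ω] (P : Measure Ω)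
    [IsProbabilityMeasure P] (B : ℝ≥0 → Ω → EuclideanSpace ℝ (Fin d))
    (hB : IsBrownianMotion B P) (T : ℝ) (hT : 0 ≤ T) (f : ℝ → ℝ) (hf : Measurable f)
    (hf_nonneg : ∀ t ∈ Set.Icc 0 T, 0 ≤ f t) :
    (∀ V : EuclideanSpace ℝ (Fin d) → ℝ≥0∞, IsGaussianDefinite.{u} V →
      (⨆ x, expFunctional B P T f V x) = expFunctional B P T f V 0) ∧
    (∀ θ ∈ Set.Ioc (0 : ℝ) 2, IsGaussianDefinite.{0} (powerPotential d θ)) ∧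
    (∀ θ ∈ Set.Icc (0 : ℝ) 2,
      (⨆ x, expFunctional B P T f (powerPotential d θ) x) =
        expFunctional B P T f (powerPotential d θ) 0) := by
  refine ⟨fun V hV => iSup_expFunctional_eq_of_isGaussianDefinite hB T hf hV,
    fun θ hθ => isGaussianDefinite_powerPotential d hθ.1, fun θ hθ => ?_⟩
  rcases hθ.1.eq_or_lt with rfl | hpos
  -- For `θ = 0` the potential is constant.
  · simp [expFunctional, powerPotential]
  · exact iSup_expFunctional_eq_of_isGaussianDefinite hB T hf
      (isGaussianDefinite_powerPotential d hpos)
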